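/- Let $n\ge 2$ and let $X,Y$ be two disjoint copies of $[n]$. Let $M_1,\dots,M_r$ be pairwise edge-disjoint perfect matchings between $X$ and $Y$, and write $xy\in M_i$ for an edge joining $x\in X$ to $y\in Y$. For a permutation $\pi\in S_n$ let $D_\pi(M_i)$ be the digraph on $[n]$ whose edges are the pairs $u\to v$ with $u\neq v$ and $u\,\pi^{-1}(v)\in M_i$. It is a disjoint union of directed cycles and isolated vertices. For $w\in[n]$ let $c_{i,w}$ be the length of the directed cycle of $D_\pi(M_i)$ containing $w$, with $c_{i,w}=1$ if $w$ is isolated. Let $\pi\in S_n$ be chosen uniformly at random. (1) There is an absolute constant $C>0$ such that for all $n\ge 2$, all $r$, all such families $M_1,\dots,M_r$ and every $w\in[n]$, $$\mathbb E\left[\Big(\sum_{i=1}^r \frac1{c_{i,w}}\Big)^3\right]\le C\,\frac rn\,\log^3 n .$$ (2) Consequently, there is an absolute constant $C>0$ such that, with high probability, for every $w\in[n]$, $$\sum_{i=1}^r \frac1{c_{i,w}}\le C\,(r\log^4 n)^{1/3}.$$ That is, for every $\varepsilon>0$ there is $N$ such that for all $n\ge N$, all $r$ and all such families $M_1,\dots,M_r$,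 this holds simultaneously for all $w\in[n]$ with probability at least $1-\varepsilon$. -/

import Mathlib

/-- A balanced bipartite graph whose parts `X` (left summand) and `Y` (right summand) are two
disjoint copies of `[n]`: a subgraph of the complete bipartite graph `K_{n,n}`. -/
abbrev BalancedBip (n : ℕ) : Type :=
  (completeBipartiteGraph (Fin n) (Fin n)).Subgraph

/-- The digraph `D_π(B)` on `[n]`: it has the edge `i → j` exactly when `i ≠ j` and the vertex
`i ∈ X` is joined in `B` to the vertex `π⁻¹(j) ∈ Y`. -/
def permDigraph {n : ℕ} (π : Equiv.Perm (Fin n)) (B : BalancedBip n) : Digraph (Fin n) where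
  Adj i j := B.Adj (Sum.inl i) (Sum.inr (π.symm j)) ∧ i ≠ j

/-- `D` has a directed cycle of length `ℓ` through `w`: there are pairwise distinct vertices
`w = c 0, c 1, …, c (ℓ - 1)` and edges `c 0 → c 1 → ⋯ → c (ℓ - 1) → c ℓ = w`. -/
def HasCycleThrough {V : Type*} (D : Digraph V) (w : V) (ℓ : ℕ) : Prop :=
  1 ≤ ℓ ∧ ∃ c : ℕ → V, c 0 = w ∧ c ℓ = w ∧ Set.InjOn c (Set.Iio ℓ) ∧
    ∀ k < ℓ, D.Adj (c k) (c (k + 1))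

/-- `w` is an isolated vertex of `D`. -/
def IsIsolatedVertex {V : Type*} (D : Digraph V) (w : V) : Prop :=
  ∀ u, ¬ D.Adj w u ∧ ¬ D.Adj u w

open Classical in
/-- The length of the directed cycle of `D` that contains `w`, with value `1` if `w` is isolated.
In a disjoint union of directed cycles and isolated vertices, every vertex that is not isolated
lies on exactly one cycle, so the infimum is over a one-element set. -/
noncomputable def cycleLength {V : Type*} (D : Digraph V) (w : V) : ℕ :=
  if IsIsolatedVertex D w then 1 else sInf {ℓ : ℕ | HasCycleThrough D w ℓ}

/-- The sum `∑ i, 1 / c_{i,w}`, where `c_{i,w}` is the length of the cycle containing `w` in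
`D_π(M_i)`. -/
noncomputable def invCycleSum {n r : ℕ} (M : Fin r → BalancedBip n) (π : Equiv.Perm (Fin n))
    (w : Fin n) : ℝ :=
  ∑ i : Fin r, 1 / (cycleLength (permDigraph π (M i)) w : ℝ)

/-- Expectation of `f π` for a uniformly random permutation `π` of `[n]`. -/
noncomputable def permExpect (n : ℕ) (f : Equiv.Perm (Fin n) → ℝ) : ℝ :=
  (∑ π : Equiv.Perm (Fin n), f π) / (Fintype.card (Equiv.Perm (Fin n)) : ℝ)

open Classical in
/-- Probability of the event `P π` for a uniformly random permutation `π` of `[n]`. -/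
noncomputable def permProb (n : ℕ) (P : Equiv.Perm (Fin n) → Prop) : ℝ :=
  ((Finset.univ.filter fun π : Equiv.Perm (Fin n) => P π).card : ℝ) /
    (Fintype.card (Equiv.Perm (Fin n)) : ℝ)

/-- `M_1, …, M_r` are pairwise edge-disjoint perfect matchings between the two copies of `[n]`. -/
def EdgeDisjointPerfectMatchings {n r : ℕ} (M : Fin r → BalancedBip n) : Prop :=
  (∀ i, (M i).IsPerfectMatching) ∧
    ∀ i j, i ≠ j → Disjoint (M i).edgeSet (M j).edgeSet

/-! Each matching is a permutation `σ i`, and `c_{i,w}` is a return time of `w` under `π * σ i`;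
edge-disjointness makes the labels `e i = σ i w` distinct. The core is a switching argument for at
most three indices (`sum_prod_truncated_inv_le`). If the cycles through `w` all have length at most
`n/8`, there are at least `(n/4)^t` choices of new labels `y` off these cycles; let `g` exchange
each `e i` with `y i`. Breaking a cycle at its first edge leaves a path, so `π * g`, a stopping
label and a step count below the cycle length recover the broken edge, hence `π` and `y`. Weighting
by inverse lengths gives harmonic sums, so joint moments are at most those of independent variables
of mean `O(log n / n)`.

Expanding the cube (`sum_cube_le_of_joint_moments`) and using `r ≤ n` gives the moment bound; longer
cycles contribute only `O(r/n)`. Markov's inequality and a union bound over `w` give the second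
claim. -/

/-! ### Exchanging labels and tracing the broken cycle. -/

/-- Two injective families with disjoint ranges are exchanged by a permutation that fixes
everything else. -/
theorem exists_perm_exchanging {ι α : Type*} (e y : ι → α) (he : e.Injective) (hy : y.Injective)
    (hd : ∀ i j, e i ≠ y j) :
    ∃ g : Equiv.Perm α, (∀ i, g (e i) = y i) ∧ (∀ i, g (y i) = e i) ∧
      ∀ x, (∀ i, x ≠ e i) → (∀ i, x ≠ y i) → g x = x := by
  classical
  let f : α → α := fun x =>
    if h : ∃ i, e i = x then y h.choose else if h : ∃ i, y i = x then e h.choose else x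
  have f1 : ∀ i, f (e i) = y i := by
    intro i
    have h : ∃ j, e j = e i := ⟨i, rfl⟩
    simp only [f, dif_pos h]
    rw [he h.choose_spec]
  have f2 : ∀ i, f (y i) = e i := by
    intro i
    have h0 : ¬ ∃ j, e j = y i := by rintro ⟨j, hj⟩; exact hd _ _ hj
    have h : ∃ j, y j = y i := ⟨i, rfl⟩
    simp only [f, dif_neg h0, dif_pos h]
    rw [hy h.choose_spec]
  have f3 : ∀ x, (∀ i, x ≠ e i) → (∀ i, x ≠ y i) → f x = x := by
    intro x h1 h2
    have h0 : ¬ ∃ j, e j = x := by rintro ⟨j, hj⟩; exact h1 _ hj.symm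
    have h : ¬ ∃ j, y j = x := by rintro ⟨j, hj⟩; exact h2 _ hj.symm
    simp only [f, dif_neg h0, dif_neg h]
  have hf : Function.Involutive f := by
    intro x
    by_cases h1 : ∃ i, x = e i
    · obtain ⟨i, rfl⟩ := h1
      rw [f1, f2]
    · by_cases h2 : ∃ i, x = y i
      · obtain ⟨i, rfl⟩ := h2
        rw [f2, f1]
      · push Not at h1 h2
        rw [f3 x h1 h2, f3 x h1 h2]
  exact ⟨hf.toPerm f, f1, f2, f3⟩

/-- Injective families avoiding a small set are plentiful. -/
theorem pow_le_card_injective_avoiding {ι α : Type*} [Fintype ι] [DecidableEq ι] [Fintype α]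
    [DecidableEq α] (B : Finset α) :
    (Fintype.card α - B.card + 1 - Fintype.card ι) ^ Fintype.card ι ≤
      (Finset.univ.filter fun y : ι → α => y.Injective ∧ ∀ i, y i ∉ B).card := by
  classical
  have h1 : Fintype.card (ι ↪ {x // x ∉ B}) ≤
      (Finset.univ.filter fun y : ι → α => y.Injective ∧ ∀ i, y i ∉ B).card := by
    rw [← Finset.card_univ]
    refine Finset.card_le_card_of_injOn (fun f i => (f i : α)) ?_ ?_
    · intro f _
      simp only [Finset.coe_filter, Finset.mem_univ, true_and, Set.mem_ofPred_eq]
      exact ⟨Subtype.val_injective.comp f.injective, fun i => (f i).2⟩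
    · intro f _ g _ h
      ext i
      exact congrFun h i
  refine le_trans ?_ h1
  rw [Fintype.card_embedding_eq]
  have h2 : Fintype.card {x // x ∉ B} = Fintype.card α - B.card := by
    rw [Fintype.card_subtype_compl]; simp
  rw [h2]
  -- Every factor of the falling factorial is at least its last one.
  exact Nat.pow_sub_le_descFactorial _ _

/-- Breaking the cycle of `π * s` through `w` at its first edge: the head of the broken edge is
found by walking backwards from a tail of one of the exchanged labels. -/
theorem exists_backward_walk {ι α : Type*} (e y : ι → α) (π g s : Equiv.Perm α) (w : α) (c : ℕ)
    (hc : 1 ≤ c) (hw : ((π * s) ^ c) w = w) (l : ι) (hl : e l = s w)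
    (hyB : ∀ k < c, ∀ i, y i ≠ s (((π * s) ^ k) w))
    (hg : ∀ x, (∀ i, x ≠ e i) → (∀ i, x ≠ y i) → g x = x) :
    ∃ m : ι, ∃ k : ℕ, k < c ∧ (((π * g) * s) ^ k) (π (e l)) = s.symm (e m) := by
  classical
  -- The old cycle meets an exchanged label at the latest on returning to `w`. Up to the first such
  -- time `g` fixes every label met, so old and new walks agree.
  have hex : ∃ k, k < c ∧ ∃ m, s (((π * s) ^ (k + 1)) w) = e m := by
    refine ⟨c - 1, by omega, l, ?_⟩
    rw [Nat.sub_add_cancel hc, hw, hl]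
  obtain ⟨hkc, m, hm⟩ := Nat.find_spec hex
  have hmin : ∀ j < Nat.find hex, ∀ i, s (((π * s) ^ (j + 1)) w) ≠ e i := by
    intro j hj i h
    exact Nat.find_min hex hj ⟨hj.trans hkc, i, h⟩
  refine ⟨m, Nat.find hex, hkc, ?_⟩
  have key : ∀ j ≤ Nat.find hex,
      (((π * g) * s) ^ j) (π (e l)) = ((π * s) ^ (j + 1)) w := by
    intro j
    induction j with
    | zero => intro _; simp [hl]
    | succ j ih =>
      intro hj
      have hj' : j < Nat.find hex := hj
      rw [pow_succ', Equiv.Perm.mul_apply, ih hj'.le, pow_succ' _ (j + 1),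
        Equiv.Perm.mul_apply, Equiv.Perm.mul_apply, Equiv.Perm.mul_apply, Equiv.Perm.mul_apply]
      rw [hg _ (hmin j hj') fun i h => hyB (j + 1) (by omega) i h.symm]
  rw [key _ le_rfl, ← hm, Equiv.symm_apply_apply]

/-! ### Joint moments by switching. -/

/-- Joint moment bound: for permutations `σ i` (at most three) with distinct values at `w`, the
truncated inverse cycle lengths of `π * σ i` at `w` are nearly independent. -/
theorem sum_prod_truncated_inv_le {n : ℕ} {ι : Type*} [Fintype ι] [DecidableEq ι]
    (hn : 16 ≤ n) (hι : Fintype.card ι ≤ 3) (σ : ι → Equiv.Perm (Fin n)) (w : Fin n)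
    (hσ : Function.Injective fun i => σ i w) (c : Equiv.Perm (Fin n) → ι → ℕ)
    (hc : ∀ π i, 1 ≤ c π i → ((π * σ i) ^ c π i) w = w) :
    (∑ π : Equiv.Perm (Fin n), ∏ i, (if 8 * c π i ≤ n then 1 / (c π i : ℝ) else 0)) *
        ((n : ℝ) / 4) ^ Fintype.card ι ≤
      (Fintype.card (Equiv.Perm (Fin n)) : ℝ) *
        ((Fintype.card ι : ℝ) * ∑ k ∈ Finset.range n, 1 / ((k : ℝ) + 1)) ^ Fintype.card ι := by
  classical
  set t := Fintype.card ι with ht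
  let e : ι → Fin n := fun i => σ i w
  let good : Equiv.Perm (Fin n) → Prop := fun π => ∀ i, 1 ≤ c π i ∧ 8 * c π i ≤ n
  let B : Equiv.Perm (Fin n) → Finset (Fin n) := fun π =>
    Finset.univ.biUnion fun i => (Finset.range (c π i)).image fun k => σ i (((π * σ i) ^ k) w)
  let Y : Equiv.Perm (Fin n) → Finset (ι → Fin n) := fun π =>
    Finset.univ.filter fun y => y.Injective ∧ ∀ i, y i ∉ B π
  let P : Finset (Equiv.Perm (Fin n) × (ι → Fin n)) :=
    Finset.univ.filter fun p => good p.1 ∧ p.2 ∈ Y p.1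
  have hBmem : ∀ π i k, k < c π i → σ i (((π * σ i) ^ k) w) ∈ B π := by
    intro π i k hk
    simp only [B, Finset.mem_biUnion, Finset.mem_univ, true_and, Finset.mem_image,
      Finset.mem_range]
    exact ⟨i, k, hk, rfl⟩
  have hd : ∀ π y, good π → y ∈ Y π → ∀ i j, e i ≠ y j := by
    intro π y hπ hy i j h
    simp only [Y, Finset.mem_filter, Finset.mem_univ, true_and] at hy
    have := hBmem π i 0 (hπ i).1
    apply hy.2 j
    rw [← h]
    simpa using this
  have hyinj : ∀ π y, y ∈ Y π → y.Injective := by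
    intro π y hy
    simp only [Y, Finset.mem_filter, Finset.mem_univ, true_and] at hy
    exact hy.1
  -- number of admissible `y`
  have hYcard : ∀ π, good π → ((n : ℝ) / 4) ^ t ≤ ((Y π).card : ℝ) := by
    intro π hπ
    -- The cutoff `n/8` is chosen here: three cycles use at most `3n/8` labels, leaving more than
    -- `n/4` for each `y i`.
    have hB : 8 * (B π).card ≤ 3 * n := by
      have h1 : (B π).card ≤ ∑ i, c π i :=
        Finset.card_biUnion_le.trans
          (Finset.sum_le_sum fun i _ => Finset.card_image_le.trans (by simp))
      have h2 : 8 * ∑ i, c π i ≤ t * n := by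
        rw [Finset.mul_sum]
        refine (Finset.sum_le_sum fun i _ => (hπ i).2).trans ?_
        simp [ht]
      have h3 : t * n ≤ 3 * n := Nat.mul_le_mul_right _ hι
      omega
    have h := pow_le_card_injective_avoiding (ι := ι) (B π)
    rw [Fintype.card_fin] at h
    have h4 : (n : ℝ) / 4 ≤ ((n - (B π).card + 1 - t : ℕ) : ℝ) := by
      have : n ≤ 4 * (n - (B π).card + 1 - t) := by omega
      have : (n : ℝ) ≤ 4 * ((n - (B π).card + 1 - t : ℕ) : ℝ) := by exact_mod_cast this
      linarith
    calc ((n : ℝ) / 4) ^ t ≤ ((n - (B π).card + 1 - t : ℕ) : ℝ) ^ t :=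
          pow_le_pow_left₀ (by positivity) h4 _
      _ ≤ ((Y π).card : ℝ) := by exact_mod_cast h
  -- the exchange and its trace
  have hG : ∀ y : ι → Fin n, y.Injective ∧ (∀ i j, e i ≠ y j) →
      ∃ g : Equiv.Perm (Fin n), (∀ i, g (e i) = y i) ∧ (∀ i, g (y i) = e i) ∧
        ∀ x, (∀ i, x ≠ e i) → (∀ i, x ≠ y i) → g x = x :=
    fun y hy => exists_perm_exchanging e y hσ hy.1 hy.2
  choose! G hG1 hG2 hG3 using hG
  have htrace : ∀ p : Equiv.Perm (Fin n) × (ι → Fin n), p ∈ P → ∀ l, ∃ m : ι, ∃ k : ℕ,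
      k < c p.1 l ∧ (((p.1 * G p.2) * σ l) ^ k) (p.1 (e l)) = (σ l).symm (e m) := by
    rintro ⟨π, y⟩ hp l
    simp only [P, Finset.mem_filter, Finset.mem_univ, true_and] at hp
    obtain ⟨hπ, hy⟩ := hp
    have hcond : y.Injective ∧ ∀ i j, e i ≠ y j := ⟨hyinj _ _ hy, hd _ _ hπ hy⟩
    refine exists_backward_walk e y π (G y) (σ l) w (c π l) (hπ l).1 (hc π l (hπ l).1) l rfl ?_
      (hG3 y hcond)
    intro k hk i h
    simp only [Y, Finset.mem_filter, Finset.mem_univ, true_and] at hy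
    exact hy.2 i (h ▸ hBmem π l k hk)
  choose! m k hk hmk using htrace
  let Φ : Equiv.Perm (Fin n) × (ι → Fin n) → Equiv.Perm (Fin n) × ((ι → ι) × (ι → ℕ)) :=
    fun p => (p.1 * G p.2, m p, k p)
  have hPspec : ∀ p ∈ P, good p.1 ∧ p.2.Injective ∧ ∀ i j, e i ≠ p.2 j := by
    intro p hp
    simp only [P, Finset.mem_filter, Finset.mem_univ, true_and] at hp
    exact ⟨hp.1, hyinj _ _ hp.2, hd _ _ hp.1 hp.2⟩
  -- Undoing the recorded number of steps from the recorded endpoint yields `π (e l)`; its preimage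
  -- under `π * g` is `y l`. Then `y` determines `g`, hence `π`.
  have hΦ : Set.InjOn Φ (P : Set (Equiv.Perm (Fin n) × (ι → Fin n))) := by
    intro p hp q hq h
    have hp' := hPspec p hp
    have hq' := hPspec q hq
    simp only [Φ, Prod.mk.injEq] at h
    obtain ⟨h1, h2, h3⟩ := h
    have h4 : ∀ l, p.1 (e l) = q.1 (e l) := by
      intro l
      have ha := hmk p hp l
      have hb := hmk q hq l
      rw [← h1, ← h2, ← h3, ← ha] at hb
      exact ((Equiv.injective _) hb).symm
    have h5 : p.2 = q.2 := by
      funext l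
      apply (p.1 * G p.2).injective
      have e1 : (p.1 * G p.2) (p.2 l) = p.1 (e l) := by
        rw [Equiv.Perm.mul_apply, hG2 _ hp'.2]
      have e2 : (p.1 * G p.2) (q.2 l) = q.1 (e l) := by
        rw [h1, Equiv.Perm.mul_apply, hG2 _ hq'.2]
      rw [e1, e2, h4]
    refine Prod.ext ?_ h5
    rw [h5] at h1
    exact mul_right_cancel h1
  -- weighted double count
  let T : Finset (Equiv.Perm (Fin n) × ((ι → ι) × (ι → ℕ))) :=
    Finset.univ ×ˢ (Finset.univ ×ˢ Fintype.piFinset fun _ => Finset.range n)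
  let f : Equiv.Perm (Fin n) × ((ι → ι) × (ι → ℕ)) → ℝ := fun q => ∏ i, 1 / ((q.2.2 i : ℝ) + 1)
  -- The `t ^ t` choices of stopping labels become the factor `t` inside the power.
  have hTsum : ∑ q ∈ T, f q = (Fintype.card (Equiv.Perm (Fin n)) : ℝ) *
        ((t : ℝ) * ∑ k ∈ Finset.range n, 1 / ((k : ℝ) + 1)) ^ t := by
    simp only [T, f, Finset.sum_product]
    rw [Finset.sum_const, Finset.sum_const, ← Finset.prod_univ_sum (fun _ => Finset.range n)
      (fun _ k => 1 / ((k : ℝ) + 1))]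
    simp only [Finset.prod_const, Finset.card_univ, Fintype.card_fun, nsmul_eq_mul, ← ht]
    rw [mul_pow]
    push_cast
    ring
  have hΦT : P.image Φ ⊆ T := by
    intro q hq
    obtain ⟨p, hp, rfl⟩ := Finset.mem_image.1 hq
    simp only [T, Φ, Finset.mem_product, Finset.mem_univ, true_and, Fintype.mem_piFinset,
      Finset.mem_range]
    intro l
    have h1 := hk p hp l
    have h2 := ((hPspec p hp).1 l).2
    omega
  have hfnn : ∀ q, 0 ≤ f q := fun q => Finset.prod_nonneg fun i _ => by positivity
  have hP : ∑ p ∈ P, ∏ i, (1 / (c p.1 i : ℝ)) ≤ ∑ q ∈ T, f q := by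
    calc ∑ p ∈ P, ∏ i, (1 / (c p.1 i : ℝ)) ≤ ∑ p ∈ P, f (Φ p) := by
          refine Finset.sum_le_sum fun p hp => Finset.prod_le_prod (fun i _ => by positivity) ?_
          intro i _
          refine one_div_le_one_div_of_le (by positivity) ?_
          exact_mod_cast hk p hp i
      _ = ∑ q ∈ P.image Φ, f q := (Finset.sum_image hΦ).symm
      _ ≤ ∑ q ∈ T, f q := Finset.sum_le_sum_of_subset_of_nonneg hΦT fun q _ _ => hfnn q
  rw [← hTsum]
  refine le_trans ?_ hP
  have hPsum : ∑ p ∈ P, ∏ i, (1 / (c p.1 i : ℝ)) =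
      ∑ π : Equiv.Perm (Fin n), if good π then ((Y π).card : ℝ) * ∏ i, (1 / (c π i : ℝ)) else 0 := by
    simp only [P]
    rw [Finset.sum_filter, Fintype.sum_prod_type]
    refine Finset.sum_congr rfl fun π _ => ?_
    by_cases hπ : good π
    · simp only [hπ, true_and, if_true]
      rw [← Finset.sum_filter, Finset.sum_const, nsmul_eq_mul]
      congr 3
      ext y
      simp
    · simp [hπ]
  rw [hPsum, Finset.sum_mul]
  refine Finset.sum_le_sum fun π _ => ?_
  by_cases hπ : good π
  · rw [if_pos hπ, mul_comm]
    have : ∏ i, (if 8 * c π i ≤ n then 1 / (c π i : ℝ) else 0) = ∏ i, (1 / (c π i : ℝ)) :=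
      Finset.prod_congr rfl fun i _ => if_pos (hπ i).2
    rw [this]
    exact mul_le_mul_of_nonneg_right (hYcard π hπ) (Finset.prod_nonneg fun i _ => by positivity)
  · rw [if_neg hπ]
    have : ∃ i, ¬ (1 ≤ c π i ∧ 8 * c π i ≤ n) := by simpa [good] using hπ
    obtain ⟨i, hi⟩ := this
    rw [Finset.prod_eq_zero (Finset.mem_univ i), zero_mul]
    -- A length `0` is harmless, since `1 / 0 = 0`.
    split_ifs with h
    · have : c π i = 0 := by by_contra h0; exact hi ⟨Nat.one_le_iff_ne_zero.2 h0, h⟩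
      simp [this]
    · rfl

/-! ### From matchings to permutations. -/

/-- A perfect matching of `K_{n,n}` is the graph of a permutation. -/
theorem exists_perm_of_isPerfectMatching {n : ℕ} (M : BalancedBip n) (h : M.IsPerfectMatching) :
    ∃ σ : Equiv.Perm (Fin n), ∀ x y, M.Adj (Sum.inl x) (Sum.inr y) ↔ σ x = y := by
  have hex : ∀ x : Fin n, ∃ y : Fin n, M.Adj (Sum.inl x) (Sum.inr y) := by
    intro x
    obtain ⟨v, hv, -⟩ := h.1 (h.2 (Sum.inl x))
    rcases v with v | v
    · have := M.adj_sub hv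
      simp [completeBipartiteGraph] at this
    · exact ⟨v, hv⟩
  choose f hf using hex
  have hinj : f.Injective := by
    intro x x' hxx
    have h1 := hf x
    rw [hxx] at h1
    exact Sum.inl.inj (h.1.eq_of_adj_right h1 (hf x'))
  refine ⟨Equiv.ofBijective f (Finite.injective_iff_bijective.1 hinj), fun x y => ?_⟩
  simp only [Equiv.ofBijective_apply]
  exact ⟨fun hxy => Sum.inr.inj (h.1.eq_of_adj_left (hf x) hxy), fun hxy => hxy ▸ hf x⟩

/-- Edge-disjoint perfect matchings are given by permutations that disagree everywhere. -/
theorem EdgeDisjointPerfectMatchings.exists_perms {n r : ℕ} {M : Fin r → BalancedBip n}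
    (h : EdgeDisjointPerfectMatchings M) :
    ∃ σ : Fin r → Equiv.Perm (Fin n),
      (∀ i x y, (M i).Adj (Sum.inl x) (Sum.inr y) ↔ σ i x = y) ∧
        ∀ w, Function.Injective fun i => σ i w := by
  choose σ hσ using fun i => exists_perm_of_isPerfectMatching (M i) (h.1 i)
  refine ⟨σ, hσ, fun w i j hij => ?_⟩
  by_contra hne
  have h1 : (M i).Adj (Sum.inl w) (Sum.inr (σ i w)) := (hσ i _ _).2 rfl
  have h2 : (M j).Adj (Sum.inl w) (Sum.inr (σ i w)) := (hσ j _ _).2 hij.symm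
  exact Set.disjoint_left.1 (h.2 i j hne) (SimpleGraph.Subgraph.mem_edgeSet.2 h1)
    (SimpleGraph.Subgraph.mem_edgeSet.2 h2)

/-- The switching argument needs only a return time, not minimality. Assuming length at least `1`
excludes the default `sInf ∅ = 0`; an isolated vertex is a fixed point. -/
theorem pow_cycleLength_apply {n : ℕ} (M : BalancedBip n) (σ π : Equiv.Perm (Fin n))
    (hσ : ∀ x y, M.Adj (Sum.inl x) (Sum.inr y) ↔ σ x = y) (w : Fin n)
    (h : 1 ≤ cycleLength (permDigraph π M) w) :
    ((π * σ) ^ cycleLength (permDigraph π M) w) w = w := by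
  have hadj : ∀ u v, (permDigraph π M).Adj u v ↔ (π * σ) u = v ∧ u ≠ v := by
    intro u v
    simp only [permDigraph, hσ, Equiv.Perm.mul_apply, Equiv.eq_symm_apply]
  unfold cycleLength at h ⊢
  split_ifs at h ⊢ with hiso
  · rw [pow_one]
    by_contra hne
    exact (hiso ((π * σ) w)).1 ((hadj _ _).2 ⟨rfl, fun h => hne h.symm⟩)
  · have hmem := Nat.sInf_mem (Nat.nonempty_of_pos_sInf h)
    obtain ⟨-, c, h0, hl, -, hc⟩ := hmem
    generalize sInf {ℓ : ℕ | HasCycleThrough (permDigraph π M) w ℓ} = L at *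
    have key : ∀ k ≤ L, ((π * σ) ^ k) w = c k := by
      intro k
      induction k with
      | zero => intro _; simp [h0]
      | succ k ih =>
        intro hk
        rw [pow_succ', Equiv.Perm.mul_apply, ih (by omega)]
        exact ((hadj _ _).1 (hc k hk)).1
    rw [key L le_rfl, hl]

/-! ### The third moment. -/

/-- Third moment of a sum of `[0,1]`-valued variables whose joint moments are at most those of
independent variables of mean `q`. -/
theorem sum_cube_le_of_joint_moments {Ω ι : Type*} [Fintype Ω] [Fintype ι] [DecidableEq ι]
    (X : Ω → ι → ℝ) (q N : ℝ) (hq : 0 ≤ q) (hN : 0 ≤ N) (hX0 : ∀ a i, 0 ≤ X a i)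
    (hX1 : ∀ a i, X a i ≤ 1)
    (h : ∀ I : Finset ι, I.card ≤ 3 → ∑ a, ∏ i ∈ I, X a i ≤ N * q ^ I.card) :
    ∑ a, (∑ i, X a i) ^ 3 ≤
      N * ((Fintype.card ι * q) ^ 3 + 3 * (Fintype.card ι * q) ^ 2 + Fintype.card ι * q) := by
  have h1 : ∀ i, ∑ a, X a i ≤ N * q := fun i => by simpa using h {i} (by simp)
  have h2 : ∀ i j, i ≠ j → ∑ a, X a i * X a j ≤ N * q ^ 2 := fun i j hij => by
    simpa [Finset.prod_pair hij, Finset.card_pair hij] using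
      h {i, j} (by rw [Finset.card_pair hij]; omega)
  have h3 : ∀ i j k, i ≠ j → i ≠ k → j ≠ k → ∑ a, X a i * X a j * X a k ≤ N * q ^ 3 := by
    intro i j k hij hik hjk
    have hcard : ({i, j, k} : Finset ι).card = 3 := Finset.card_eq_three.2
      ⟨i, j, k, hij, hik, hjk, rfl⟩
    have := h {i, j, k} hcard.le
    rw [hcard] at this
    refine le_of_eq_of_le (Finset.sum_congr rfl fun a _ => ?_) this
    rw [Finset.prod_insert (by simp [hij, hik]), Finset.prod_pair hjk, mul_assoc]
  -- Since `X ^ 2 ≤ X` on `[0,1]`, repeated indices reduce to lower joint moments; the indicators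
  -- record the coincidences.
  have hpt : ∀ i j k, ∑ a, X a i * X a j * X a k ≤
      N * (q ^ 3 + ((if i = j then 1 else 0) + (if j = k then 1 else 0) +
        (if i = k then 1 else 0)) * q ^ 2 + (if i = j then if j = k then 1 else 0 else 0) * q) := by
    intro i j k
    have n1 : 0 ≤ N * q := mul_nonneg hN hq
    have n2 : 0 ≤ N * q ^ 2 := mul_nonneg hN (by positivity)
    have n3 : 0 ≤ N * q ^ 3 := mul_nonneg hN (by positivity)
    have m2 : ∀ a i j, X a i * X a i * X a j ≤ X a i * X a j := fun a i j =>
      mul_le_mul_of_nonneg_right (mul_le_of_le_one_left (hX0 a i) (hX1 a i)) (hX0 a j)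
    have m1 : ∀ a i, X a i * X a i * X a i ≤ X a i := fun a i =>
      (m2 a i i).trans (mul_le_of_le_one_left (hX0 a i) (hX1 a i))
    by_cases hij : i = j
    · subst hij
      by_cases hjk : i = k
      · subst hjk
        have := (Finset.sum_le_sum fun a _ => m1 a i).trans (h1 i)
        simp only [if_true]
        linarith
      · have := (Finset.sum_le_sum fun a _ => m2 a i k).trans (h2 i k hjk)
        simp only [if_true, hjk, if_false]
        linarith
    · by_cases hjk : j = k
      · subst hjk
        have := (Finset.sum_le_sum fun a _ => m2 a j i).trans (h2 j i (Ne.symm hij))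
        have e : ∑ a, X a i * X a j * X a j = ∑ a, X a j * X a j * X a i :=
          Finset.sum_congr rfl fun a _ => by ring
        rw [e]
        simp only [if_true, hij, if_false]
        linarith
      · by_cases hik : i = k
        · subst hik
          have := (Finset.sum_le_sum fun a _ => m2 a i j).trans (h2 i j hij)
          have e : ∑ a, X a i * X a j * X a i = ∑ a, X a i * X a i * X a j :=
            Finset.sum_congr rfl fun a _ => by ring
          rw [e]
          simp only [if_true, hij, hjk, if_false]
          linarith
        · have := h3 i j k hij hik hjk
          simp only [hij, hjk, hik, if_false]
          linarith
  have hexp : ∑ a, (∑ i, X a i) ^ 3 = ∑ i, ∑ j, ∑ k, ∑ a, X a i * X a j * X a k := by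
    have : ∀ a, (∑ i, X a i) ^ 3 = ∑ i, ∑ j, ∑ k, X a i * X a j * X a k := by
      intro a
      rw [pow_succ, sq, Finset.sum_mul_sum, Finset.sum_mul]
      refine Finset.sum_congr rfl fun i _ => ?_
      rw [Finset.sum_mul_sum]
    simp only [this]
    rw [Finset.sum_comm]
    refine Finset.sum_congr rfl fun i _ => ?_
    rw [Finset.sum_comm]
    refine Finset.sum_congr rfl fun j _ => ?_
    rw [Finset.sum_comm]
  rw [hexp]
  refine (Finset.sum_le_sum fun i _ => Finset.sum_le_sum fun j _ => Finset.sum_le_sum fun k _ =>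
    hpt i j k).trans (le_of_eq ?_)
  simp only [← Finset.mul_sum, Finset.sum_add_distrib, ← Finset.sum_mul, Finset.sum_const,
    Finset.card_univ, nsmul_eq_mul, Finset.sum_ite_eq, Finset.mem_univ, if_true]
  have e2 : ∑ i : ι, ∑ j : ι, (if i = j then (∑ k : ι, if j = k then (1 : ℝ) else 0) else 0) =
      Fintype.card ι := by simp
  have e1 : ∑ i : ι, ∑ j : ι, ∑ k : ι, (if i = j then if j = k then (1 : ℝ) else 0 else 0) =
      Fintype.card ι := by
    rw [← e2]
    refine Finset.sum_congr rfl fun i _ => Finset.sum_congr rfl fun j _ => ?_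
    split_ifs <;> simp
  rw [e1]
  ring

theorem sum_range_one_div_le_two_mul_log {n : ℕ} (hn : 16 ≤ n) :
    ∑ k ∈ Finset.range n, 1 / ((k : ℝ) + 1) ≤ 2 * Real.log n := by
  have h1 : 1 ≤ Real.log n := by
    rw [Real.le_log_iff_exp_le (by positivity)]
    have : (16 : ℝ) ≤ n := by exact_mod_cast hn
    linarith [Real.exp_one_lt_d9]
  have h2 := harmonic_le_one_add_log n
  have h3 : ((harmonic n : ℚ) : ℝ) = ∑ k ∈ Finset.range n, 1 / ((k : ℝ) + 1) := by
    simp [harmonic]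
  linarith

theorem invCycleSum_nonneg {n r : ℕ} (M : Fin r → BalancedBip n) (π : Equiv.Perm (Fin n))
    (w : Fin n) : 0 ≤ invCycleSum M π w :=
  Finset.sum_nonneg fun _ _ => by positivity

theorem one_div_natCast_le_one (c : ℕ) : 1 / (c : ℝ) ≤ 1 := by
  rw [one_div]; exact Nat.cast_inv_le_one c

theorem invCycleSum_le {n r : ℕ} (M : Fin r → BalancedBip n) (π : Equiv.Perm (Fin n))
    (w : Fin n) : invCycleSum M π w ≤ r := by
  refine (Finset.sum_le_sum fun i _ => one_div_natCast_le_one _).trans ?_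
  simp

theorem EdgeDisjointPerfectMatchings.le_card {n r : ℕ} {M : Fin r → BalancedBip n}
    (h : EdgeDisjointPerfectMatchings M) (w : Fin n) : r ≤ n := by
  obtain ⟨σ, -, hσ⟩ := h.exists_perms
  simpa using Fintype.card_le_of_injective _ (hσ w)

theorem sum_truncated_cube_le {n r : ℕ} (hn : 16 ≤ n) {M : Fin r → BalancedBip n}
    (hM : EdgeDisjointPerfectMatchings M) (w : Fin n) :
    ∑ π : Equiv.Perm (Fin n), (∑ i, if 8 * cycleLength (permDigraph π (M i)) w ≤ n then
        1 / (cycleLength (permDigraph π (M i)) w : ℝ) else 0) ^ 3 ≤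
      (Fintype.card (Equiv.Perm (Fin n)) : ℝ) * ((r * (24 * Real.log n / n)) ^ 3 +
        3 * (r * (24 * Real.log n / n)) ^ 2 + r * (24 * Real.log n / n)) := by
  obtain ⟨σ, hσ, hinj⟩ := hM.exists_perms
  have hn0 : (0 : ℝ) < n := by have : 0 < n := by omega
                               exact_mod_cast this
  have hlog : 0 ≤ Real.log n := Real.log_natCast_nonneg n
  have := sum_cube_le_of_joint_moments (Ω := Equiv.Perm (Fin n)) (ι := Fin r)
    (fun π i => if 8 * cycleLength (permDigraph π (M i)) w ≤ n then
        1 / (cycleLength (permDigraph π (M i)) w : ℝ) else 0)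
    (24 * Real.log n / n) (Fintype.card (Equiv.Perm (Fin n))) (by positivity) (by positivity)
    (fun π i => by split_ifs <;> positivity)
    (fun π i => by
      split_ifs
      · exact one_div_natCast_le_one _
      · exact zero_le_one) ?_
  · simpa only [Fintype.card_fin] using this
  intro I hI
  have hmain := sum_prod_truncated_inv_le (ι := I) hn (by simpa using hI) (fun i => σ i) w
    (fun i j hij => Subtype.ext (hinj w hij))
    (fun π i => cycleLength (permDigraph π (M i)) w)
    (fun π i hi => pow_cycleLength_apply (M i) (σ i) π (hσ i) w hi)
  rw [Fintype.card_coe] at hmain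
  have hbase : (I.card : ℝ) * ∑ k ∈ Finset.range n, 1 / ((k : ℝ) + 1) ≤ 6 * Real.log n := by
    have h1 : (I.card : ℝ) ≤ 3 := by exact_mod_cast hI
    have h2 := sum_range_one_div_le_two_mul_log hn
    calc (I.card : ℝ) * ∑ k ∈ Finset.range n, 1 / ((k : ℝ) + 1) ≤ 3 * (2 * Real.log n) :=
          mul_le_mul h1 h2 (Finset.sum_nonneg fun _ _ => by positivity) (by norm_num)
      _ = 6 * Real.log n := by ring
  have hpow := pow_le_pow_left₀ (mul_nonneg (Nat.cast_nonneg _)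
    (Finset.sum_nonneg fun _ _ => by positivity)) hbase I.card
  -- Here `24 = 3 · 2 · 4`: at most three indices, harmonic sum at most `2 log n`, and `n/4` choices
  -- per label.
  have hq : (24 * Real.log n / n : ℝ) ^ I.card * ((n : ℝ) / 4) ^ I.card =
      (6 * Real.log n) ^ I.card := by
    rw [← mul_pow]
    congr 1
    field_simp
    ring
  refine le_of_mul_le_mul_right ?_ (pow_pos (by positivity : (0 : ℝ) < n / 4) I.card)
  rw [mul_assoc, hq]
  refine le_trans (le_of_eq_of_le ?_ hmain) (mul_le_mul_of_nonneg_left hpow (by positivity))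
  congr 1
  refine Finset.sum_congr rfl fun π _ => ?_
  exact (Finset.prod_coe_sort I fun i => if 8 * cycleLength (permDigraph π (M i)) w ≤ n then
        1 / (cycleLength (permDigraph π (M i)) w : ℝ) else 0).symm

theorem permExpect_invCycleSum_cube_le {n r : ℕ} (hn : 2 ≤ n) {M : Fin r → BalancedBip n}
    (hM : EdgeDisjointPerfectMatchings M) (w : Fin n) :
    permExpect n (fun π => (invCycleSum M π w) ^ 3) ≤
      64352 * ((r : ℝ) / (n : ℝ) * Real.log (n : ℝ) ^ 3) := by
  have hn0 : (0 : ℝ) < n := by have : 0 < n := by omega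
                               exact_mod_cast this
  have hrn : (r : ℝ) ≤ n := by exact_mod_cast hM.le_card w
  have hN : (0 : ℝ) < Fintype.card (Equiv.Perm (Fin n)) := by
    exact_mod_cast Fintype.card_pos
  unfold permExpect
  rw [div_le_iff₀ hN]
  set ρ : ℝ := r / n with hρ
  have hρ0 : 0 ≤ ρ := by positivity
  have hρ1 : ρ ≤ 1 := (div_le_one hn0).2 hrn
  -- For `n < 16` the trivial bound `r ^ 3` suffices.
  rcases lt_or_ge n 16 with hsmall | hlarge
  · have hlog : 1 / 2 ≤ Real.log n := by
      have h1 : Real.log 2 ≤ Real.log n :=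
        Real.log_le_log (by norm_num) (by exact_mod_cast hn)
      linarith [Real.log_two_gt_d9]
    have hlog3 : (1 / 2 : ℝ) ^ 3 ≤ Real.log n ^ 3 := pow_le_pow_left₀ (by norm_num) hlog 3
    have hr : (r : ℝ) ^ 3 ≤ ρ * 4096 := by
      have h1 : (n : ℝ) ≤ 16 := by exact_mod_cast hsmall.le
      have h2 : (r : ℝ) ^ 3 = ρ ^ 3 * n ^ 3 := by rw [hρ]; field_simp
      have h3 : (n : ℝ) ^ 3 ≤ 16 ^ 3 := pow_le_pow_left₀ hn0.le h1 3
      have h4 : ρ ^ 3 ≤ ρ := pow_le_of_le_one hρ0 hρ1 (by norm_num)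
      rw [h2]
      calc ρ ^ 3 * (n : ℝ) ^ 3 ≤ ρ * 16 ^ 3 := mul_le_mul h4 h3 (by positivity) hρ0
        _ = ρ * 4096 := by norm_num
    have hpt : ∀ π : Equiv.Perm (Fin n), (invCycleSum M π w) ^ 3 ≤
        64352 * (ρ * Real.log n ^ 3) := by
      intro π
      have h1 : (invCycleSum M π w) ^ 3 ≤ (r : ℝ) ^ 3 :=
        pow_le_pow_left₀ (invCycleSum_nonneg M π w) (invCycleSum_le M π w) 3
      have h2 : ρ * (1 / 2 : ℝ) ^ 3 ≤ ρ * Real.log n ^ 3 := mul_le_mul_of_nonneg_left hlog3 hρ0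
      linarith
    refine (Finset.sum_le_sum fun π _ => hpt π).trans (le_of_eq ?_)
    rw [Finset.sum_const, Finset.card_univ, nsmul_eq_mul, mul_comm]
  · have hlog : 1 ≤ Real.log n := by
      rw [Real.le_log_iff_exp_le hn0]
      have : (16 : ℝ) ≤ n := by exact_mod_cast hlarge
      linarith [Real.exp_one_lt_d9]
    -- Each cycle longer than `n/8` contributes less than `8/n`; convexity of the cube gives the
    -- factors `4`.
    have hS : ∀ π : Equiv.Perm (Fin n), (invCycleSum M π w) ^ 3 ≤
        4 * (∑ i, if 8 * cycleLength (permDigraph π (M i)) w ≤ n then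
          1 / (cycleLength (permDigraph π (M i)) w : ℝ) else 0) ^ 3 + 4 * (8 * ρ) ^ 3 := by
      intro π
      have hle : invCycleSum M π w ≤
          (∑ i, if 8 * cycleLength (permDigraph π (M i)) w ≤ n then
            1 / (cycleLength (permDigraph π (M i)) w : ℝ) else 0) + 8 * ρ := by
        have h1 : ∑ _i : Fin r, (8 / n : ℝ) = 8 * ρ := by
          rw [Finset.sum_const, Finset.card_univ, Fintype.card_fin, nsmul_eq_mul, hρ]
          ring
        rw [← h1, ← Finset.sum_add_distrib]
        refine Finset.sum_le_sum fun i _ => ?_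
        split_ifs with hc
        · have : (0 : ℝ) ≤ 8 / n := by positivity
          linarith
        · rw [zero_add]
          push Not at hc
          have hc' : (n : ℝ) ≤ 8 * cycleLength (permDigraph π (M i)) w := by
            exact_mod_cast hc.le
          have hcpos : (0 : ℝ) < cycleLength (permDigraph π (M i)) w := by linarith
          rw [div_le_div_iff₀ hcpos hn0]
          linarith
      have hX : 0 ≤ ∑ i, (if 8 * cycleLength (permDigraph π (M i)) w ≤ n then
          1 / (cycleLength (permDigraph π (M i)) w : ℝ) else 0) :=
        Finset.sum_nonneg fun i _ => by split_ifs <;> positivity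
      refine (pow_le_pow_left₀ (invCycleSum_nonneg M π w) hle 3).trans ?_
      have := add_pow_le hX (by positivity : 0 ≤ 8 * ρ) 3
      norm_num at this ⊢
      linarith
    refine (Finset.sum_le_sum fun π _ => hS π).trans ?_
    rw [Finset.sum_add_distrib, ← Finset.mul_sum, Finset.sum_const, Finset.card_univ,
      nsmul_eq_mul]
    have hT := sum_truncated_cube_le hlarge hM w
    have hR : (r : ℝ) * (24 * Real.log n / n) = 24 * (ρ * Real.log n) := by
      rw [hρ]; ring
    rw [hR] at hT
    have hρ3 : ρ ^ 3 ≤ ρ := pow_le_of_le_one hρ0 hρ1 (by norm_num)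
    have hρ2 : ρ ^ 2 ≤ ρ := pow_le_of_le_one hρ0 hρ1 (by norm_num)
    have hl1 : Real.log n ≤ Real.log n ^ 3 := le_self_pow₀ hlog (by norm_num)
    have hl2 : Real.log n ^ 2 ≤ Real.log n ^ 3 := pow_le_pow_right₀ hlog (by norm_num)
    have hl0 : (1 : ℝ) ≤ Real.log n ^ 3 := one_le_pow₀ hlog
    have hlnn : 0 ≤ Real.log n := by linarith
    have b1 : ρ * Real.log n ≤ ρ * Real.log n ^ 3 := mul_le_mul_of_nonneg_left hl1 hρ0
    have b2 : ρ ^ 2 * Real.log n ^ 2 ≤ ρ * Real.log n ^ 3 :=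
      mul_le_mul hρ2 hl2 (by positivity) hρ0
    have b3 : ρ ^ 3 * Real.log n ^ 3 ≤ ρ * Real.log n ^ 3 :=
      mul_le_mul_of_nonneg_right hρ3 (by positivity)
    have b0 : ρ ^ 3 ≤ ρ * Real.log n ^ 3 := by
      simpa using mul_le_mul hρ3 hl0 zero_le_one hρ0
    -- All terms are dominated by `ρ log³ n` because `ρ ≤ 1 ≤ log n`; the coefficients sum to
    -- `64352`.
    have hpoly : 4 * ((24 * (ρ * Real.log n)) ^ 3 + 3 * (24 * (ρ * Real.log n)) ^ 2 +
        24 * (ρ * Real.log n)) + 4 * (8 * ρ) ^ 3 ≤ 64352 * (ρ * Real.log n ^ 3) := by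
      have e : 4 * ((24 * (ρ * Real.log n)) ^ 3 + 3 * (24 * (ρ * Real.log n)) ^ 2 +
        24 * (ρ * Real.log n)) + 4 * (8 * ρ) ^ 3 = 55296 * (ρ ^ 3 * Real.log n ^ 3) +
        6912 * (ρ ^ 2 * Real.log n ^ 2) + 96 * (ρ * Real.log n) + 2048 * ρ ^ 3 := by ring
      rw [e]
      linarith
    have := mul_le_mul_of_nonneg_left hpoly hN.le
    linarith

/-! ### The high-probability bound. -/

/-- Markov's inequality for the third moment together with a union bound. -/
theorem one_sub_le_permProb_of_cube {n : ℕ} (S : Equiv.Perm (Fin n) → Fin n → ℝ) (a b : ℝ)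
    (ha : 0 < a) (hS : ∀ π w, 0 ≤ S π w)
    (h : ∀ w, permExpect n (fun π => S π w ^ 3) ≤ b) :
    1 - n * b / a ^ 3 ≤ permProb n fun π => ∀ w, S π w ≤ a := by
  classical
  have hN : (0 : ℝ) < Fintype.card (Equiv.Perm (Fin n)) := by
    exact_mod_cast Fintype.card_pos
  have ha3 : 0 < a ^ 3 := by positivity
  unfold permProb
  rw [le_div_iff₀ hN]
  have hpt : ∀ π : Equiv.Perm (Fin n),
      1 - (∑ w, S π w ^ 3) / a ^ 3 ≤ if ∀ w, S π w ≤ a then (1 : ℝ) else 0 := by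
    intro π
    have hnn : ∀ w ∈ Finset.univ, 0 ≤ S π w ^ 3 := fun w _ => pow_nonneg (hS π w) 3
    split_ifs with hw
    · have : 0 ≤ (∑ w, S π w ^ 3) / a ^ 3 := div_nonneg (Finset.sum_nonneg hnn) ha3.le
      linarith
    · push Not at hw
      obtain ⟨w, hw⟩ := hw
      rw [sub_nonpos, one_le_div ha3]
      exact (pow_le_pow_left₀ ha.le hw.le 3).trans
        (Finset.single_le_sum hnn (Finset.mem_univ w))
  have hsum := Finset.sum_le_sum fun π (_ : π ∈ Finset.univ) => hpt π
  rw [Finset.sum_boole, Finset.sum_sub_distrib, ← Finset.sum_div, Finset.sum_comm] at hsum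
  have hE : ∑ w, ∑ π, S π w ^ 3 ≤ n * (b * Fintype.card (Equiv.Perm (Fin n))) := by
    refine (Finset.sum_le_sum fun w _ => (div_le_iff₀ hN).1 (h w)).trans (le_of_eq ?_)
    simp
  have hE' := div_le_div_of_nonneg_right hE ha3.le
  simp only [Finset.sum_const, Finset.card_univ, nsmul_eq_mul, mul_one] at hsum
  have e : (1 - n * b / a ^ 3) * (Fintype.card (Equiv.Perm (Fin n)) : ℝ) =
      Fintype.card (Equiv.Perm (Fin n)) -
        n * (b * Fintype.card (Equiv.Perm (Fin n))) / a ^ 3 := by ring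
  rw [e]
  refine le_trans ?_ (hsum.trans (le_of_eq ?_))
  · linarith
  · congr

theorem permProb_of_forall {n : ℕ} {P : Equiv.Perm (Fin n) → Prop} (h : ∀ π, P π) :
    permProb n P = 1 := by
  have hN : (Fintype.card (Equiv.Perm (Fin n)) : ℝ) ≠ 0 := by
    exact_mod_cast Fintype.card_ne_zero
  unfold permProb
  simp only [h, Finset.filter_true, Finset.card_univ]
  exact div_self hN

theorem proposition4p7 :
    (∃ C : ℝ, 0 < C ∧ ∀ (n r : ℕ) (M : Fin r → BalancedBip n), 2 ≤ n →
      EdgeDisjointPerfectMatchings M → ∀ w : Fin n,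
        permExpect n (fun π => (invCycleSum M π w) ^ 3)
          ≤ C * ((r : ℝ) / (n : ℝ) * Real.log (n : ℝ) ^ 3)) ∧
    (∃ C : ℝ, 0 < C ∧ ∀ ε : ℝ, 0 < ε → ∃ N : ℕ, ∀ (n r : ℕ) (M : Fin r → BalancedBip n), N ≤ n →
      EdgeDisjointPerfectMatchings M →
        1 - ε ≤ permProb n (fun π => ∀ w : Fin n,
          invCycleSum M π w ≤ C * ((r : ℝ) * Real.log (n : ℝ) ^ 4) ^ ((1 : ℝ) / 3))) := by
  refine ⟨⟨64352, by norm_num, fun n r M hn hM w => permExpect_invCycleSum_cube_le hn hM w⟩,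
    1, one_pos, fun ε hε => ?_⟩
  obtain ⟨N, hN⟩ := Filter.eventually_atTop.1 ((Real.tendsto_log_atTop.comp
    tendsto_natCast_atTop_atTop).eventually_ge_atTop (64352 / ε))
  refine ⟨max N 2, fun n r M hn hM => ?_⟩
  have hn2 : 2 ≤ n := (le_max_right _ _).trans hn
  have hlogε : 64352 / ε ≤ Real.log n := hN n ((le_max_left _ _).trans hn)
  have hlog : 0 < Real.log n := lt_of_lt_of_le (by positivity) hlogε
  have hn0 : (0 : ℝ) < n := by have : 0 < n := by omega
                               exact_mod_cast this
  -- Markov's inequality needs a positive threshold, so `r = 0` is separate.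
  rcases Nat.eq_zero_or_pos r with rfl | hr
  · rw [permProb_of_forall]
    · linarith
    · intro π w
      simp [invCycleSum]
  have hr0 : (0 : ℝ) < r := by exact_mod_cast hr
  have hbase : 0 < (r : ℝ) * Real.log n ^ 4 := by positivity
  refine le_trans ?_ (one_sub_le_permProb_of_cube (invCycleSum M) _ _ (by positivity)
    (invCycleSum_nonneg M) fun w => permExpect_invCycleSum_cube_le hn2 hM w)
  have hcube : (1 * ((r : ℝ) * Real.log n ^ 4) ^ ((1 : ℝ) / 3)) ^ 3 = r * Real.log n ^ 4 := by
    rw [one_mul, ← Real.rpow_natCast, ← Real.rpow_mul hbase.le]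
    norm_num
  rw [hcube]
  -- The fourth power of the logarithm leaves a failure probability `O(1 / log n)`, so `C = 1`
  -- works.
  have e : n * (64352 * ((r : ℝ) / n * Real.log n ^ 3)) / (r * Real.log n ^ 4) =
      64352 / Real.log n := by
    field_simp
  rw [e]
  have : 64352 / Real.log n ≤ ε := by
    rw [div_le_iff₀ hlog]
    rw [div_le_iff₀ hε] at hlogε
    linarith
  linarith
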